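/- Let $\Bbbk$ be a field, let $S=\Bbbk[x_1,\dots,x_n]$ with its fine $\mathbb Z^n$-grading and $\mathfrak m=\langle x_1,\dots,x_n\rangle$, and let $I\subsetneq S$ be a proper ideal generated by squarefree monomials. Let $$\mathbb F:\quad\cdots\xrightarrow{\partial}\mathbb F_2\xrightarrow{\partial}\mathbb F_1\xrightarrow{\partial}\mathbb F_0=S\to S/I\to 0$$ be the minimal $\mathbb Z^n$-graded free resolution of $S/I$, so each $\mathbb F_p$ is a $\mathbb Z^n$-graded free $S$-module of finite rank, $\partial$ respects the multigrading, and $\partial\mathbb F\subseteq\mathfrak m\mathbb F$. Identify $\mathbb F$ with $\bigoplus_p\mathbb F_p$; write $|a|=p$ for $a\in\mathbb F_p$ and $\deg a\in\mathbb Z^n$ for the multidegree of a homogeneous element $a$. A *multiplication* on $\mathbb F$ is an $S$-linear map $*:\mathbb F\otimes_S\mathbb F\to\mathbb F$ (not necessarily associative) which extends the multiplication of $\mathbb F_0=S$, satisfies the Leibniz rule $\partial(a*b)=\partial a*b+(-1)^{|a|}a*\partial b$, satisfies $|a*b|=|a|+|b|$ and $a*b=(-1)^{|a||b|}\,b*a$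 (for $a,b$ homogeneous with respect to the homological grading), and respects the multigrading, i.e. $\deg(a*b)=\deg a+\deg b$ for multihomogeneous $a,b$ whenever $a*b\neq 0$. For a homogeneous element $f\in\mathbb F$, its *squarefree part* $|f|_{\mathrm{sqf}}$ is the unique homogeneous $f'\in\mathbb F$ of multidegree $\deg(f)\wedge(1,\dots,1)$ (componentwise minimum) such that $f=mf'$ for some monomial $m\in S$; we set $|0|_{\mathrm{sqf}}=0$. A multidegree is called squarefree if it is componentwise at most $(1,\dots,1)$. **Proposition 3.4.** Let $*$ be any multiplication on $\mathbb F$, let $p\ge 1$, and let $f\in\mathbb F_p$ be a homogeneous element of squarefree multidegree. Then there are finitely many homogeneous elements $g_{\ell,j}\in\mathbb F_1$ ($1\le\ell\le p$, $1\le j\le N$) such that every product below has a squarefree part and $$f=\sum_{j=1}^{N}\bigl|\,g_{1,j}*(g_{2,j}*(\cdots(g_{p-1,j}*g_{p,j})\cdots))\,\bigr|_{\mathrm{sqf}} .$$ -/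

import Mathlib

open MvPolynomial

namespace SqfRes

universe u v w

variable {k : Type u} [Field k] {n : ℕ}

/-- `I ⊆ k[x_1, …, x_n]` is a squarefree monomial ideal: it is generated by a set of monomials
all of whose exponents are at most one. -/
def IsSquarefreeMonomialIdeal (I : Ideal (MvPolynomial (Fin n) k)) : Prop :=
  ∃ A : Set (Fin n →₀ ℕ), (∀ a ∈ A, ∀ i, a i ≤ 1) ∧
    I = Ideal.span ((fun a => monomial a (1 : k)) '' A)

/-- A free module `F = ⨁ F_p` over `S = k[x_1, …, x_n]` with a homological grading and a fine
`ℤⁿ`-grading, given by an `S`-basis of bihomogeneous elements: the basis element `basis b` has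
homological degree `hdeg b` and multidegree `mdeg b`. -/
structure MultigradedFree (k : Type u) [Field k] (n : ℕ) (B : Type v) (F : Type w)
    [AddCommGroup F] [Module (MvPolynomial (Fin n) k) F] where
  basis : Module.Basis B (MvPolynomial (Fin n) k) F
  hdeg : B → ℕ
  mdeg : B → Fin n → ℤ

namespace MultigradedFree

variable {B : Type v} {F : Type w} [AddCommGroup F] [Module (MvPolynomial (Fin n) k) F]

/-- The component `F_p` of homological degree `p`. -/
noncomputable def comp (G : MultigradedFree k n B F) (p : ℕ) : Submodule (MvPolynomial (Fin n) k) F :=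
  Submodule.span (MvPolynomial (Fin n) k) (G.basis '' {b | G.hdeg b = p})

/-- `f` is homogeneous of multidegree `d`: every term `c x^a e_b` in its expansion has multidegree
`a + mdeg b = d`. The zero element is homogeneous of every multidegree. -/
def HasMultidegree (G : MultigradedFree k n B F) (d : Fin n → ℤ) (f : F) : Prop :=
  ∀ b, ∀ a ∈ (G.basis.repr f b).support, (fun i => (a i : ℤ)) + G.mdeg b = d

/-- `f'` is the squarefree part of the homogeneous element `f`: `f = x^a f'` for a monomial `x^a`,
and the multidegree of `f'` is the componentwise minimum of that of `f` with `(1, …, 1)`. -/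
def IsSquarefreePart (G : MultigradedFree k n B F) (f f' : F) : Prop :=
  ∃ (d : Fin n → ℤ) (a : Fin n →₀ ℕ), G.HasMultidegree d f ∧ G.HasMultidegree (d ⊓ 1) f' ∧
    f = monomial a (1 : k) • f'

/-- There is at most one squarefree part. -/
theorem IsSquarefreePart.unique {G : MultigradedFree k n B F} {f f₁ f₂ : F}
    (h₁ : G.IsSquarefreePart f f₁) (h₂ : G.IsSquarefreePart f f₂) : f₁ = f₂ := by
  -- the exponent of the monomial is determined as soon as `f'` is nonzero
  have key : ∀ {f' : F} {d : Fin n → ℤ} {a : Fin n →₀ ℕ}, f ≠ 0 → G.HasMultidegree d f →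
      G.HasMultidegree (d ⊓ 1) f' → f = monomial a (1 : k) • f' →
      ∃ b, ∃ c ∈ (G.basis.repr f b).support, (∀ i, (c i : ℤ) + G.mdeg b i = d i) ∧
        ∀ i, (a i : ℤ) = d i - (d ⊓ 1) i := by
    intro f' d a hf hd hd' he
    have hf' : G.basis.repr f' ≠ 0 := by
      intro h
      apply hf
      rw [he, (LinearEquiv.map_eq_zero_iff _).1 h, smul_zero]
    obtain ⟨b, hb⟩ := Finsupp.ne_iff.1 hf'
    obtain ⟨c, hc⟩ := MvPolynomial.ne_zero_iff.1 hb
    have hmem : a + c ∈ (G.basis.repr f b).support := by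
      rw [MvPolynomial.mem_support_iff, he, map_smul, Finsupp.smul_apply, smul_eq_mul,
        MvPolynomial.coeff_monomial_mul, one_mul]
      exact hc
    have e1 := hd b _ hmem
    have e2 := hd' b c (MvPolynomial.mem_support_iff.2 hc)
    refine ⟨b, a + c, hmem, fun i => congrFun e1 i, fun i => ?_⟩
    have e1i := congrFun e1 i
    have e2i := congrFun e2 i
    simp only [Pi.add_apply, Finsupp.add_apply, Nat.cast_add] at e1i e2i
    linarith
  have tf : ∀ {a : Fin n →₀ ℕ} {y z : F},
      monomial a (1 : k) • y = monomial a (1 : k) • z → y = z := by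
    intro a y z h
    apply G.basis.repr.injective
    ext1 b
    have h' := congrArg (fun x => G.basis.repr x b) h
    simp only [map_smul, Finsupp.smul_apply, smul_eq_mul] at h'
    exact mul_left_cancel₀ (by simp) h'
  obtain ⟨d₁, a₁, hd₁, hd₁', he₁⟩ := h₁
  obtain ⟨d₂, a₂, hd₂, hd₂', he₂⟩ := h₂
  by_cases hf : f = 0
  · have z₁ : f₁ = 0 := tf (a := a₁) (by rw [← he₁, hf, smul_zero])
    have z₂ : f₂ = 0 := tf (a := a₂) (by rw [← he₂, hf, smul_zero])
    rw [z₁, z₂]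
  · obtain ⟨b, c, hc, hcd, ha₁⟩ := key hf hd₁ hd₁' he₁
    obtain ⟨-, -, -, -, ha₂⟩ := key hf hd₂ hd₂' he₂
    have hd : d₁ = d₂ := (hd₁ b c hc).symm.trans (hd₂ b c hc)
    have ha : a₁ = a₂ := by
      ext i
      have h1 := ha₁ i
      have h2 := ha₂ i
      rw [hd] at h1
      exact_mod_cast h1.trans h2.symm
    subst ha
    exact tf (he₁.symm.trans he₂)

end MultigradedFree

/-- A minimal multigraded free resolution
`⋯ → F_2 → F_1 → F_0 = S → S/I → 0` of `S/I` over `S = k[x_1, …, x_n]`, written as the free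
bigraded module `F = ⨁ F_p` together with its differential. -/
structure MinimalResolution (I : Ideal (MvPolynomial (Fin n) k)) (B : Type v) (F : Type w)
    [AddCommGroup F] [Module (MvPolynomial (Fin n) k) F] extends MultigradedFree k n B F where
  /-- every `F_p` has finite rank -/
  finite_rank : ∀ p, {b | hdeg b = p}.Finite
  /-- the index of the basis element `1` of `F_0 = S` -/
  oneIdx : B
  hdeg_eq_zero_iff : ∀ b, hdeg b = 0 ↔ b = oneIdx
  mdeg_oneIdx : mdeg oneIdx = 0
  /-- the differential -/
  d : F →ₗ[MvPolynomial (Fin n) k] F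
  d_zero : ∀ f ∈ toMultigradedFree.comp 0, d f = 0
  d_succ : ∀ p, ∀ f ∈ toMultigradedFree.comp (p + 1), d f ∈ toMultigradedFree.comp p
  d_multidegree : ∀ e f, toMultigradedFree.HasMultidegree e f →
    toMultigradedFree.HasMultidegree e (d f)
  d_comp_d : ∀ f, d (d f) = 0
  /-- exactness at `F_0 = S`: the image of `F_1` is the kernel `I` of `S → S/I` -/
  exact_zero : ∀ s : MvPolynomial (Fin n) k,
    s ∈ I ↔ ∃ y ∈ toMultigradedFree.comp 1, d y = s • basis oneIdx
  /-- exactness in positive homological degrees -/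
  exact_succ : ∀ p, ∀ z ∈ toMultigradedFree.comp (p + 1), d z = 0 →
    ∃ y ∈ toMultigradedFree.comp (p + 2), d y = z
  /-- minimality: `∂F ⊆ 𝔪F` with `𝔪 = ⟨x_1, …, x_n⟩` -/
  minimal : ∀ f, d f ∈ idealOfVars (Fin n) k •
    (⊤ : Submodule (MvPolynomial (Fin n) k) F)

/-- A multiplication on `F`: an `S`-linear map `F ⊗ F → F` (given as a bilinear map) that satisfies
all axioms of a differential graded algebra except possibly associativity, and that respects the
multigrading. -/
structure Multiplication {I : Ideal (MvPolynomial (Fin n) k)} {B : Type v} {F : Type w}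
    [AddCommGroup F] [Module (MvPolynomial (Fin n) k) F] (R : MinimalResolution I B F) where
  mul : F →ₗ[MvPolynomial (Fin n) k] F →ₗ[MvPolynomial (Fin n) k] F
  /-- `*` extends the multiplication of `F_0 = S` -/
  mul_zero_zero : ∀ s t : MvPolynomial (Fin n) k,
    mul (s • R.basis R.oneIdx) (t • R.basis R.oneIdx) = (s * t) • R.basis R.oneIdx
  leibniz : ∀ p, ∀ a ∈ R.comp p, ∀ b, R.d (mul a b) = mul (R.d a) b + (-1 : ℤ) ^ p • mul a (R.d b)
  mul_mem_comp : ∀ p q, ∀ a ∈ R.comp p, ∀ b ∈ R.comp q, mul a b ∈ R.comp (p + q)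
  graded_comm : ∀ p q, ∀ a ∈ R.comp p, ∀ b ∈ R.comp q, mul a b = (-1 : ℤ) ^ (p * q) • mul b a
  mul_multidegree : ∀ d e a b, R.HasMultidegree d a → R.HasMultidegree e b →
    R.HasMultidegree (d + e) (mul a b)

/-- The right-nested product `g_1 * (g_2 * (⋯ (g_{p-1} * g_p) ⋯))` of a nonempty list; the value at
the empty list is irrelevant. -/
noncomputable def Multiplication.nestedProd {I : Ideal (MvPolynomial (Fin n) k)} {B : Type v} {F : Type w}
    [AddCommGroup F] [Module (MvPolynomial (Fin n) k) F] {R : MinimalResolution I B F}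
    (M : Multiplication R) : List F → F
  | [] => 0
  | [g] => g
  | g :: g' :: l => M.mul g (M.nestedProd (g' :: l))

end SqfRes

namespace SqfRes

universe u v w

variable {k : Type u} [Field k] {n : ℕ}

/-! ### Multigraded free modules -/

namespace MultigradedFree

variable {B : Type v} {F : Type w} [AddCommGroup F] [Module (MvPolynomial (Fin n) k) F]
  (G : MultigradedFree k n B F)

/-! The proof is by induction on homological degree, then on total multidegree. In degree at least 2
it suffices to treat a basis element `b`, because a monomial coefficient can be absorbed into the
first factor of a product. Choose `g` in `F_1` with `∂g = x^a` and `x^a` dividing the multidegree of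
`b`. If `b = 1 * v`, Leibniz gives `x^a b = ∂(g * v) + g * ∂v`.

All basis multidegrees are squarefree (`mdeg_le_one`), so `g * v = x^a y` and `g * ∂v = x^a z`;
cancelling gives `b = ∂y + z`. By the outer induction `∂v` is a sum of squarefree parts of shorter
products, hence `z` is a sum of squarefree parts of products with one more factor. By minimality
only basis elements of smaller total degree occur in `∂y`, and the inner induction handles them.

The axioms do not make 1 act as the identity in positive homological degree. The element `v` exists
because left multiplication by 1 is onto (`exists_one_mul`). -/

theorem mem_comp_iff {p : ℕ} {f : F} :
    f ∈ G.comp p ↔ ∀ b, G.basis.repr f b ≠ 0 → G.hdeg b = p := by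
  unfold comp
  rw [Module.Basis.mem_span_image]
  simp [Set.subset_def]

theorem basis_mem_comp (b : B) : G.basis b ∈ G.comp (G.hdeg b) :=
  Submodule.subset_span ⟨b, rfl, rfl⟩

theorem hasMultidegree_basis (b : B) : G.HasMultidegree (G.mdeg b) (G.basis b) := by
  intro b' a ha
  rw [Module.Basis.repr_self, mem_support_iff] at ha
  by_cases h : b = b'
  · subst h
    rw [Finsupp.single_eq_same, coeff_one] at ha
    have : a = 0 := by
      by_contra h0
      exact ha (if_neg (Ne.symm h0))
    subst this
    ext i
    simp
  · rw [Finsupp.single_eq_of_ne (Ne.symm h)] at ha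
    simp at ha

variable {G}

theorem hasMultidegree_zero (e : Fin n → ℤ) : G.HasMultidegree e 0 := by
  intro b a ha
  simp at ha

theorem HasMultidegree.add {e : Fin n → ℤ} {f g : F} (hf : G.HasMultidegree e f)
    (hg : G.HasMultidegree e g) : G.HasMultidegree e (f + g) := by
  intro b a ha
  rw [map_add, Finsupp.add_apply] at ha
  exact (Finset.mem_union.1 (support_add ha)).elim (hf b a) (hg b a)

theorem HasMultidegree.sub {e : Fin n → ℤ} {f g : F} (hf : G.HasMultidegree e f)
    (hg : G.HasMultidegree e g) : G.HasMultidegree e (f - g) := by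
  rw [sub_eq_add_neg]
  refine hf.add fun b a ha => ?_
  rw [map_neg, Finsupp.neg_apply, support_neg] at ha
  exact hg b a ha

theorem HasMultidegree.monomial_smul {e : Fin n → ℤ} {f : F} (h : G.HasMultidegree e f)
    (a : Fin n →₀ ℕ) (c : k) :
    G.HasMultidegree ((fun i => (a i : ℤ)) + e) (monomial a c • f) := by
  intro b m hm
  rw [mem_support_iff, map_smul, Finsupp.smul_apply, smul_eq_mul, coeff_monomial_mul'] at hm
  split_ifs at hm with ham
  · have := h b (m - a) (mem_support_iff.2 (right_ne_zero_of_mul hm))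
    rw [← this]
    ext i
    have hi := ham i
    simp only [Pi.add_apply, Finsupp.tsub_apply, Nat.cast_sub hi]
    ring
  · exact absurd rfl hm

theorem HasMultidegree.of_monomial_smul {e : Fin n → ℤ} {f : F} {a : Fin n →₀ ℕ}
    (h : G.HasMultidegree ((fun i => (a i : ℤ)) + e) (monomial a (1 : k) • f)) :
    G.HasMultidegree e f := by
  intro b m hm
  have := h b (a + m) (by
    rw [mem_support_iff, map_smul, Finsupp.smul_apply, smul_eq_mul, coeff_monomial_mul, one_mul]
    exact mem_support_iff.1 hm)
  ext i
  have hi := congrFun this i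
  simp only [Pi.add_apply, Finsupp.add_apply, Nat.cast_add] at hi ⊢
  linarith

theorem monomial_smul_injective {a : Fin n →₀ ℕ} {y z : F}
    (h : monomial a (1 : k) • y = monomial a (1 : k) • z) (G : MultigradedFree k n B F) :
    y = z := by
  apply G.basis.repr.injective
  ext1 b
  have h' := congrArg (fun x => G.basis.repr x b) h
  simp only [map_smul, Finsupp.smul_apply, smul_eq_mul] at h'
  exact mul_left_cancel₀ (by simp) h'

theorem mem_comp_of_monomial_smul {p : ℕ} {a : Fin n →₀ ℕ} {f : F}
    (h : monomial a (1 : k) • f ∈ G.comp p) : f ∈ G.comp p := by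
  rw [mem_comp_iff] at h ⊢
  intro b hb
  apply h
  rw [map_smul, Finsupp.smul_apply, smul_eq_mul]
  exact mul_ne_zero (by simp) hb

theorem HasMultidegree.repr_eq_monomial {e : Fin n → ℤ} {f : F} (h : G.HasMultidegree e f)
    {b : B} (hb : G.basis.repr f b ≠ 0) :
    ∃ (a : Fin n →₀ ℕ) (c : k), c ≠ 0 ∧ G.basis.repr f b = monomial a c ∧
      (fun i => (a i : ℤ)) + G.mdeg b = e := by
  obtain ⟨a, ha⟩ := MvPolynomial.ne_zero_iff.1 hb
  have hae := h b a (mem_support_iff.2 ha)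
  refine ⟨a, _, ha, ?_, hae⟩
  ext m
  rw [coeff_monomial]
  split_ifs with ham
  · rw [ham]
  · by_contra hm
    apply ham
    have hme := h b m (mem_support_iff.2 hm)
    ext i
    have := congrFun (hae.trans hme.symm) i
    simpa using this

theorem sum_monomial_smul_basis (G : MultigradedFree k n B F) (f : F) :
    f = ∑ b ∈ (G.basis.repr f).support, ∑ a ∈ (G.basis.repr f b).support,
      monomial a (coeff a (G.basis.repr f b)) • G.basis b := by
  conv_lhs => rw [← G.basis.linearCombination_repr f, Finsupp.linearCombination_apply, Finsupp.sum]
  refine Finset.sum_congr rfl fun b _ => ?_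
  conv_lhs => rw [as_sum (G.basis.repr f b), Finset.sum_smul]

/-- A homogeneous element in the image of `F_p` under a multigraded map has a homogeneous
preimage in `F_p`. -/
theorem exists_hasMultidegree_preimage {p : ℕ} {T : F →ₗ[MvPolynomial (Fin n) k] F}
    (hT : ∀ e f, G.HasMultidegree e f → G.HasMultidegree e (T f)) {e : Fin n → ℤ} {v : F}
    (hv : v ∈ G.comp p) (hTv : G.HasMultidegree e (T v)) :
    ∃ v' ∈ G.comp p, G.HasMultidegree e v' ∧ T v' = T v := by
  -- The witness is the part of `v` in multidegree `e`. Requiring only that `T v - T v'` have no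
  -- term of multidegree `e` makes the claim additive in `v`, so it can be checked term by term.
  have key : ∃ v' ∈ G.comp p, G.HasMultidegree e v' ∧
      ∀ b, ∀ a ∈ (G.basis.repr (T v - T v') b).support, (fun i => (a i : ℤ)) + G.mdeg b ≠ e := by
    rw [G.sum_monomial_smul_basis v]
    have hadd : ∀ x y : F,
        (∃ v' ∈ G.comp p, G.HasMultidegree e v' ∧ ∀ b,
          ∀ a ∈ (G.basis.repr (T x - T v') b).support, (fun i => (a i : ℤ)) + G.mdeg b ≠ e) →
        (∃ v' ∈ G.comp p, G.HasMultidegree e v' ∧ ∀ b,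
          ∀ a ∈ (G.basis.repr (T y - T v') b).support, (fun i => (a i : ℤ)) + G.mdeg b ≠ e) →
        ∃ v' ∈ G.comp p, G.HasMultidegree e v' ∧ ∀ b,
          ∀ a ∈ (G.basis.repr (T (x + y) - T v') b).support,
            (fun i => (a i : ℤ)) + G.mdeg b ≠ e := by
      rintro x y ⟨x', hx, hxe, hx'⟩ ⟨y', hy, hye, hy'⟩
      refine ⟨x' + y', add_mem hx hy, hxe.add hye, fun b a ha => ?_⟩
      rw [map_add, map_add, add_sub_add_comm, map_add, Finsupp.add_apply] at ha
      exact (Finset.mem_union.1 (support_add ha)).elim (hx' b a) (hy' b a)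
    have hzero : ∃ v' ∈ G.comp p, G.HasMultidegree e v' ∧ ∀ b,
        ∀ a ∈ (G.basis.repr (T 0 - T v') b).support, (fun i => (a i : ℤ)) + G.mdeg b ≠ e :=
      ⟨0, zero_mem _, hasMultidegree_zero e, by simp⟩
    refine Finset.sum_induction _ _ hadd hzero fun b hb => ?_
    refine Finset.sum_induction _ _ hadd hzero fun a _ => ?_
    have hbp : G.hdeg b = p := G.mem_comp_iff.1 hv b (Finsupp.mem_support_iff.1 hb)
    have hm := (G.hasMultidegree_basis b).monomial_smul a (coeff a (G.basis.repr v b))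
    by_cases hae : (fun i => (a i : ℤ)) + G.mdeg b = e
    · exact ⟨_, Submodule.smul_mem _ _ (hbp ▸ G.basis_mem_comp b), hae ▸ hm, by simp⟩
    · refine ⟨0, zero_mem _, hasMultidegree_zero e, fun b' a' ha' => ?_⟩
      rw [map_zero, sub_zero] at ha'
      rw [hT _ _ hm b' a' ha']
      exact hae
  obtain ⟨v', hv', hve, hne⟩ := key
  refine ⟨v', hv', hve, (sub_eq_zero.1 (G.basis.repr.injective ?_)).symm⟩
  rw [map_zero]
  ext b a
  by_contra ha
  have ha' : a ∈ (G.basis.repr (T v - T v') b).support := mem_support_iff.2 ha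
  refine hne b a ha' ?_
  exact (hTv.sub (hT _ _ hve)) b a ha'

theorem exists_eq_monomial_smul (G : MultigradedFree k n B F) {a : Fin n →₀ ℕ} {f : F}
    (h : ∀ b, ∀ c ∈ (G.basis.repr f b).support, a ≤ c) :
    ∃ z, f = monomial a (1 : k) • z := by
  refine ⟨G.basis.repr.symm ((G.basis.repr f).mapRange (fun x => x.divMonomial a)
    (zero_divMonomial a)), ?_⟩
  apply G.basis.repr.injective
  ext1 b
  rw [map_smul, LinearEquiv.apply_symm_apply, Finsupp.smul_apply, Finsupp.mapRange_apply,
    smul_eq_mul]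
  ext m
  rw [coeff_monomial_mul']
  split_ifs with ham
  · rw [coeff_divMonomial, add_tsub_cancel_of_le ham, one_mul]
  · by_contra hm
    exact ham (h b m (mem_support_iff.2 hm))

/-- Elements of multidegree `a + e` are divisible by `x^a` if `e` is the squarefree part of
`a + e` and all basis elements have squarefree multidegree. -/
theorem HasMultidegree.exists_squarefreePart (hG : ∀ b, G.mdeg b ≤ 1) {e : Fin n → ℤ}
    {a : Fin n →₀ ℕ} {f : F} (h : G.HasMultidegree ((fun i => (a i : ℤ)) + e) f)
    (hae : ((fun i => (a i : ℤ)) + e) ⊓ 1 = e) :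
    ∃ z, G.HasMultidegree e z ∧ f = monomial a (1 : k) • z := by
  obtain ⟨z, hz⟩ := G.exists_eq_monomial_smul (a := a) (f := f) (by
    intro b c hc i
    have h1 := congrFun (h b c hc) i
    have h2 := congrFun hae i
    have h3 := hG b i
    simp only [Pi.add_apply, Pi.inf_apply, Pi.one_apply] at h1 h2 h3
    omega)
  exact ⟨z, HasMultidegree.of_monomial_smul (hz ▸ h), hz⟩

theorem constantCoeff_repr_eq_zero {f : F}
    (hf : f ∈ idealOfVars (Fin n) k • (⊤ : Submodule (MvPolynomial (Fin n) k) F)) (b : B) :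
    constantCoeff (G.basis.repr f b) = 0 := by
  have hI : idealOfVars (Fin n) k ≤ RingHom.ker (constantCoeff (R := k) (σ := Fin n)) := by
    rw [idealOfVars, Ideal.span_le]
    rintro _ ⟨i, rfl⟩
    simp
  refine Submodule.smul_induction_on hf (fun r hr x _ => ?_) (fun x y hx hy => ?_)
  · have : constantCoeff r = 0 := hI hr
    rw [map_smul, Finsupp.smul_apply, smul_eq_mul, map_mul, this, zero_mul]
  · rw [map_add, Finsupp.add_apply, map_add, hx, hy, add_zero]

end MultigradedFree

open MultigradedFree

/-! ### Consequences of minimality and exactness -/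

namespace MinimalResolution

variable {I : Ideal (MvPolynomial (Fin n) k)} {B : Type v} {F : Type w}
    [AddCommGroup F] [Module (MvPolynomial (Fin n) k) F] (R : MinimalResolution I B F)

/-- Modulo `𝔪` the right side vanishes, whereas a basis element does not. -/
theorem basis_ne_d_add_X_smul (b : B) (y z : F) (i : Fin n) :
    R.basis b ≠ R.d y + (monomial (Finsupp.single i 1) (1 : k)) • z := by
  intro h
  have h1 := congrArg (fun f => constantCoeff (R.basis.repr f b)) h
  simp only [map_add, Finsupp.add_apply, map_smul, Finsupp.smul_apply, smul_eq_mul, map_mul,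
    Module.Basis.repr_self, Finsupp.single_eq_same, map_one,
    constantCoeff_repr_eq_zero (R.minimal y) b] at h1
  rw [constantCoeff_monomial, if_neg (by simp)] at h1
  simp at h1

theorem d_basis_ne_zero {p : ℕ} {b : B} (hb : R.hdeg b = p + 1) : R.d (R.basis b) ≠ 0 := by
  intro h
  obtain ⟨y, -, hy⟩ := R.exact_succ p _ (hb ▸ R.basis_mem_comp b) h
  have h1 := constantCoeff_repr_eq_zero (G := R.toMultigradedFree) (R.minimal y) b
  rw [hy] at h1
  simp at h1

theorem eq_smul_of_mem_comp_zero {f : F} (hf : f ∈ R.comp 0) :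
    f = R.basis.repr f R.oneIdx • R.basis R.oneIdx := by
  apply R.basis.repr.injective
  ext1 b
  rw [map_smul, Module.Basis.repr_self, Finsupp.smul_apply]
  by_cases h : b = R.oneIdx
  · subst h
    simp
  · rw [Finsupp.single_eq_of_ne h, smul_zero]
    by_contra hb
    exact h ((R.hdeg_eq_zero_iff b).1 (R.mem_comp_iff.1 hf b hb))

/-- The multidegrees in the minimal resolution of a squarefree monomial ideal are squarefree. -/
theorem mdeg_le_one (hI : IsSquarefreeMonomialIdeal I) (b : B) : R.mdeg b ≤ 1 := by
  obtain ⟨p, hp⟩ : ∃ p, R.hdeg b = p := ⟨_, rfl⟩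
  induction p generalizing b with
  | zero =>
    rw [(R.hdeg_eq_zero_iff b).1 hp, R.mdeg_oneIdx]
    exact zero_le_one
  | succ p ih =>
    intro i
    by_contra hi'
    have hi : (1 : ℤ) < R.mdeg b i := lt_of_not_ge hi'
    have hbc : R.basis b ∈ R.comp (p + 1) := hp ▸ R.basis_mem_comp b
    have hdc := R.d_succ p _ hbc
    have hdm := R.d_multidegree _ _ (R.hasMultidegree_basis b)
    -- Basis elements one degree lower have `i`-th degree at most 1, and that of `b` exceeds 1, so
    -- `x_i` divides every coefficient of `∂b`.
    obtain ⟨z, hz⟩ := R.exists_eq_monomial_smul (a := Finsupp.single i 1) (f := R.d (R.basis b)) (by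
      intro b' c hc
      have h1 := congrFun (hdm b' c hc) i
      have h2 := ih b' (R.mem_comp_iff.1 hdc b' (by rintro h; simp [h] at hc)) i
      simp only [Pi.add_apply, Pi.one_apply] at h1 h2
      rw [Finsupp.single_le_iff]
      omega)
    have hzc : z ∈ R.comp p := mem_comp_of_monomial_smul (hz ▸ hdc)
    obtain ⟨y, hy, hyz⟩ : ∃ y ∈ R.comp (p + 1), R.d y = z := by
      cases p with
      | succ q =>
        refine R.exact_succ q z hzc ?_
        apply monomial_smul_injective (a := Finsupp.single i 1) _ R.toMultigradedFree
        rw [← map_smul, ← hz, R.d_comp_d, smul_zero]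
      | zero =>
        rw [R.eq_smul_of_mem_comp_zero hzc]
        set t := R.basis.repr z R.oneIdx with ht
        refine (R.exact_zero t).1 ?_
        -- Every term of `x_i t` has `x_i`-exponent at least 2, so `x_i` still divides the terms of
        -- `t`. A squarefree generator dividing a term of `x_i t` therefore divides the
        -- corresponding term of `t`.
        have hs : monomial (Finsupp.single i 1) (1 : k) * t ∈ I := by
          refine (R.exact_zero _).2 ⟨_, hbc, ?_⟩
          rw [hz, mul_smul, ht, ← R.eq_smul_of_mem_comp_zero hzc]
        obtain ⟨A, hA, rfl⟩ := hI
        rw [mem_ideal_span_monomial_image] at hs ⊢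
        intro c hc
        obtain ⟨s, hsA, hs⟩ := hs (Finsupp.single i 1 + c) (by
          rw [mem_support_iff, coeff_monomial_mul, one_mul]
          exact mem_support_iff.1 hc)
        refine ⟨s, hsA, fun j => ?_⟩
        have h1 := hdm R.oneIdx (Finsupp.single i 1 + c) (by
          rw [hz, map_smul, Finsupp.smul_apply, smul_eq_mul, mem_support_iff, coeff_monomial_mul,
            one_mul]
          exact mem_support_iff.1 hc)
        have h2 := hs j
        rw [R.mdeg_oneIdx] at h1
        have h3 := congrFun h1 i
        by_cases hij : i = j
        · subst hij
          have h4 := hA s hsA i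
          simp only [Pi.add_apply, Finsupp.add_apply, Finsupp.single_eq_same, Pi.zero_apply] at h3
          push_cast at h3
          omega
        · simpa [Finsupp.single_apply, hij] using h2
    -- This cycle is a boundary, which puts `b` in `𝔪F`, contrary to minimality.
    have h0 : R.d (R.basis b - monomial (Finsupp.single i 1) (1 : k) • y) = 0 := by
      rw [map_sub, map_smul, hyz, ← hz, sub_self]
    obtain ⟨x, -, hx⟩ := R.exact_succ p _ (sub_mem hbc (Submodule.smul_mem _ _ hy)) h0
    exact R.basis_ne_d_add_X_smul b x y i (by rw [hx, sub_add_cancel])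

/-- Below the multidegree of each basis element of positive homological degree there is a
monomial of `I`, which is hit by an element of `F_1`. -/
theorem exists_monomial_le_mdeg {p : ℕ} {b : B} (hb : R.hdeg b = p + 1) :
    ∃ g ∈ R.comp 1, ∃ a : Fin n →₀ ℕ, R.HasMultidegree (fun i => (a i : ℤ)) g ∧
      R.d g = monomial a (1 : k) • R.basis R.oneIdx ∧ (fun i => (a i : ℤ)) ≤ R.mdeg b := by
  induction p generalizing b with
  | zero =>
    rw [zero_add] at hb
    have hbc : R.basis b ∈ R.comp 1 := hb ▸ R.basis_mem_comp b
    have hd := R.eq_smul_of_mem_comp_zero (R.d_succ 0 _ hbc)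
    have hne : R.basis.repr (R.d (R.basis b)) R.oneIdx ≠ 0 := by
      intro h
      rw [h, zero_smul] at hd
      exact R.d_basis_ne_zero hb hd
    obtain ⟨a, c, hc, hac, hae⟩ :=
      (R.d_multidegree _ _ (R.hasMultidegree_basis b)).repr_eq_monomial hne
    rw [R.mdeg_oneIdx, add_zero] at hae
    refine ⟨monomial 0 c⁻¹ • R.basis b, Submodule.smul_mem _ _ hbc, a, ?_, ?_, hae.le⟩
    · have := (R.hasMultidegree_basis b).monomial_smul 0 c⁻¹
      rw [hae]
      convert this using 1
      ext i
      simp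
    · rw [map_smul, hd, hac, ← mul_smul, monomial_mul, zero_add, inv_mul_cancel₀ hc]
  | succ p ih =>
    have hbc : R.basis b ∈ R.comp (p + 2) := hb ▸ R.basis_mem_comp b
    obtain ⟨b', hb'⟩ : ∃ b', R.basis.repr (R.d (R.basis b)) b' ≠ 0 := by
      by_contra! h
      exact R.d_basis_ne_zero hb (R.basis.repr.injective (by ext1 b'; simp [h b']))
    obtain ⟨a', c, -, -, hae⟩ :=
      (R.d_multidegree _ _ (R.hasMultidegree_basis b)).repr_eq_monomial hb'
    obtain ⟨g, hg, a, hga, hgd, hle⟩ := ih (R.mem_comp_iff.1 (R.d_succ (p + 1) _ hbc) b' hb')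
    refine ⟨g, hg, a, hga, hgd, hle.trans ?_⟩
    rw [← hae]
    intro i
    simp

theorem exists_exponent_ne_zero {e : Fin n → ℤ} {y : F} (hy : R.HasMultidegree e (R.d y)) {b : B}
    (hb : R.basis.repr (R.d y) b ≠ 0) :
    ∃ (a : Fin n →₀ ℕ) (i : Fin n), a i ≠ 0 ∧ (fun i => (a i : ℤ)) + R.mdeg b = e := by
  obtain ⟨a, c, hc, hac, hadd⟩ := hy.repr_eq_monomial hb
  have hc0 := constantCoeff_repr_eq_zero (G := R.toMultigradedFree) (R.minimal y) b
  obtain ⟨i, hi⟩ : ∃ i, a i ≠ 0 := by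
    by_contra! h
    have : a = 0 := by ext i; exact h i
    rw [hac, this, constantCoeff_monomial, if_pos rfl] at hc0
    exact hc hc0
  exact ⟨a, i, hi, hadd⟩

/-- The basis elements occurring in a homogeneous boundary have smaller total degree. -/
theorem sum_mdeg_toNat_lt {p : ℕ} {e : Fin n → ℤ} {y : F} (hy : R.HasMultidegree e (R.d y))
    {b : B} (hb : R.hdeg b = p + 1) (hby : R.basis.repr (R.d y) b ≠ 0) :
    (∑ i, R.mdeg b i).toNat < (∑ i, e i).toNat := by
  obtain ⟨a, i, hi, hadd⟩ := R.exists_exponent_ne_zero hy hby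
  -- Needed only for nonnegativity of the total degree, so that `toNat` preserves the strict
  -- inequality.
  obtain ⟨-, -, a', -, -, hab⟩ := R.exists_monomial_le_mdeg hb
  have hpos : 0 ≤ ∑ i, R.mdeg b i :=
    Finset.sum_nonneg fun i _ => (Int.natCast_nonneg (a' i)).trans (hab i)
  have hlt : ∑ i, R.mdeg b i < ∑ i, e i := by
    refine Finset.sum_lt_sum (fun j _ => ?_) ⟨i, Finset.mem_univ i, ?_⟩
    · have := congrFun hadd j
      simp only [Pi.add_apply] at this
      omega
    · have := congrFun hadd i
      simp only [Pi.add_apply] at this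
      omega
  omega

theorem fg_comp (p : ℕ) : (R.comp p).FG :=
  Submodule.fg_span ((R.finite_rank p).image _)

end MinimalResolution

/-! ### Left multiplication by 1 -/

namespace Multiplication

variable {I : Ideal (MvPolynomial (Fin n) k)} {B : Type v} {F : Type w}
    [AddCommGroup F] [Module (MvPolynomial (Fin n) k) F] {R : MinimalResolution I B F}
    (M : Multiplication R)

theorem one_mem_comp : R.basis R.oneIdx ∈ R.comp 0 :=
  (R.hdeg_eq_zero_iff _).2 rfl ▸ R.basis_mem_comp R.oneIdx

theorem one_mul_mem_comp {p : ℕ} {f : F} (hf : f ∈ R.comp p) :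
    M.mul (R.basis R.oneIdx) f ∈ R.comp p := by
  simpa using M.mul_mem_comp 0 p _ one_mem_comp _ hf

theorem d_one_mul (f : F) :
    R.d (M.mul (R.basis R.oneIdx) f) = M.mul (R.basis R.oneIdx) (R.d f) := by
  rw [M.leibniz 0 _ one_mem_comp, R.d_zero _ one_mem_comp]
  simp

theorem hasMultidegree_one_mul {e : Fin n → ℤ} {f : F} (hf : R.HasMultidegree e f) :
    R.HasMultidegree e (M.mul (R.basis R.oneIdx) f) := by
  have h := R.hasMultidegree_basis R.oneIdx
  rw [R.mdeg_oneIdx] at h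
  simpa using M.mul_multidegree _ _ _ _ h hf

theorem one_mul_of_mem_comp_zero {f : F} (hf : f ∈ R.comp 0) :
    M.mul (R.basis R.oneIdx) f = f := by
  rw [R.eq_smul_of_mem_comp_zero hf]
  simpa using M.mul_zero_zero 1 (R.basis.repr f R.oneIdx)

/-- A surjective left multiplication by `1` on `F_p` is injective. -/
theorem eq_zero_of_one_mul_eq_zero {p : ℕ}
    (h : ∀ z ∈ R.comp p, ∃ w ∈ R.comp p, M.mul (R.basis R.oneIdx) w = z) {w : F}
    (hw : w ∈ R.comp p) (hw0 : M.mul (R.basis R.oneIdx) w = 0) : w = 0 := by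
  have : Module.Finite (MvPolynomial (Fin n) k) (R.comp p) :=
    Module.Finite.iff_fg.2 (R.fg_comp p)
  let φ : R.comp p →ₗ[MvPolynomial (Fin n) k] R.comp p :=
    (M.mul (R.basis R.oneIdx)).restrict fun _ hf => M.one_mul_mem_comp hf
  have hφ : Function.Surjective φ := by
    rintro ⟨z, hz⟩
    obtain ⟨w, hw, rfl⟩ := h z hz
    exact ⟨⟨w, hw⟩, rfl⟩
  have hinj := OrzechProperty.injective_of_surjective_endomorphism φ hφ
  have h0 : (⟨w, hw⟩ : R.comp p) = 0 := hinj (by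
    rw [map_zero]
    exact Subtype.ext hw0)
  exact congrArg Subtype.val h0

/-- A multiplication need not be strictly unital, but left multiplication by `1` is onto. -/
theorem exists_one_mul (p : ℕ) {z : F} (hz : z ∈ R.comp p) :
    ∃ w ∈ R.comp p, M.mul (R.basis R.oneIdx) w = z := by
  -- Surjectivity in degree `p` alone does not propagate; the second clause supplies a lift of each
  -- `b` correct up to a cycle.
  suffices H : (∀ z ∈ R.comp p, ∃ w ∈ R.comp p, M.mul (R.basis R.oneIdx) w = z) ∧
      ∀ b, R.hdeg b = p + 1 → ∃ v ∈ R.comp (p + 1),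
        R.d (M.mul (R.basis R.oneIdx) v) = R.d (R.basis b) from H.1 z hz
  clear hz z
  induction p with
  | zero =>
    refine ⟨fun z hz => ⟨z, hz, M.one_mul_of_mem_comp_zero hz⟩, fun b hb => ?_⟩
    have hbc : R.basis b ∈ R.comp (0 + 1) := hb ▸ R.basis_mem_comp b
    exact ⟨_, hbc, by rw [d_one_mul, M.one_mul_of_mem_comp_zero (R.d_succ 0 _ hbc)]⟩
  | succ p ih =>
    obtain ⟨ihs, ihd⟩ := ih
    have hs : ∀ z ∈ R.comp (p + 1), ∃ w ∈ R.comp (p + 1), M.mul (R.basis R.oneIdx) w = z := by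
      suffices H : R.comp (p + 1) ≤ (R.comp (p + 1)).map (M.mul (R.basis R.oneIdx)) from
        fun z hz => H hz
      refine Submodule.span_le.2 ?_
      rintro _ ⟨b, hb, rfl⟩
      replace hb : R.hdeg b = p + 1 := hb
      induction hN : (∑ i, R.mdeg b i).toNat using Nat.strong_induction_on generalizing b with
      | _ N ihN =>
      subst hN
      have hbc : R.basis b ∈ R.comp (p + 1) := hb ▸ R.basis_mem_comp b
      have hbm := R.hasMultidegree_basis b
      obtain ⟨v, hv, hvb⟩ := ihd b hb
      obtain ⟨v', hv', hvm, hvv⟩ :=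
        exists_hasMultidegree_preimage (T := R.d ∘ₗ M.mul (R.basis R.oneIdx))
          (fun e f hf => R.d_multidegree _ _ (M.hasMultidegree_one_mul hf)) hv
          (e := R.mdeg b) (by
            rw [LinearMap.comp_apply, hvb]
            exact R.d_multidegree _ _ hbm)
      rw [LinearMap.comp_apply, LinearMap.comp_apply, hvb] at hvv
      -- The error `b - 1 * v'` is a boundary, so it involves only basis elements of smaller total
      -- degree.
      obtain ⟨x, -, hx⟩ := R.exact_succ p _ (sub_mem hbc (M.one_mul_mem_comp hv')) (by
        rw [map_sub, hvv, sub_self])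
      have hxm : R.HasMultidegree (R.mdeg b) (R.d x) := by
        rw [hx]
        exact hbm.sub (M.hasMultidegree_one_mul hvm)
      have hxc : R.d x ∈ R.comp (p + 1) := hx ▸ sub_mem hbc (M.one_mul_mem_comp hv')
      rw [← sub_add_cancel (R.basis b) (M.mul (R.basis R.oneIdx) v'), ← hx]
      refine add_mem ?_ (Submodule.mem_map_of_mem hv')
      rw [← R.basis.linearCombination_repr (R.d x), Finsupp.linearCombination_apply, Finsupp.sum]
      refine Submodule.sum_mem _ fun b' hb' => Submodule.smul_mem _ _ ?_
      rw [Finsupp.mem_support_iff] at hb'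
      have hb'c := R.mem_comp_iff.1 hxc b' hb'
      exact ihN _ (R.sum_mdeg_toNat_lt hxm hb'c hb') b' hb'c rfl
    refine ⟨hs, fun b hb => ?_⟩
    have hbc : R.basis b ∈ R.comp (p + 2) := hb ▸ R.basis_mem_comp b
    obtain ⟨w, hw, hwb⟩ := hs _ (R.d_succ _ _ hbc)
    -- Since `1 * ∂w = ∂∂b = 0`, injectivity in degree `p` makes `w` a cycle; a primitive of it is
    -- the required `v`.
    have hdw : R.d w = 0 := by
      refine M.eq_zero_of_one_mul_eq_zero ihs (R.d_succ _ _ hw) ?_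
      rw [← d_one_mul, hwb, R.d_comp_d]
    obtain ⟨v, hv, hvw⟩ := R.exact_succ p w hw hdw
    exact ⟨v, hv, by rw [d_one_mul, hvw, hwb]⟩

theorem exists_one_mul_eq {p : ℕ} {e : Fin n → ℤ} {z : F} (hz : z ∈ R.comp p)
    (hze : R.HasMultidegree e z) :
    ∃ w ∈ R.comp p, R.HasMultidegree e w ∧ M.mul (R.basis R.oneIdx) w = z := by
  obtain ⟨w, hw, rfl⟩ := M.exists_one_mul p hz
  exact exists_hasMultidegree_preimage (fun e f hf => M.hasMultidegree_one_mul hf) hw hze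

/-! ### Sums of squarefree parts of nested products -/

/-- The squarefree parts of multidegree `e` of nested products of `p` homogeneous elements
of `F_1`. -/
def nestedParts (p : ℕ) (e : Fin n → ℤ) : Set F :=
  {s | ∃ l : List F, l.length = p ∧ (∀ g ∈ l, g ∈ R.comp 1 ∧ ∃ d, R.HasMultidegree d g) ∧
    ∃ (D : Fin n → ℤ) (a : Fin n →₀ ℕ), R.HasMultidegree D (M.nestedProd l) ∧ D ⊓ 1 = e ∧
      R.HasMultidegree e s ∧ M.nestedProd l = monomial a (1 : k) • s}

theorem nestedProd_smul_cons (r : MvPolynomial (Fin n) k) (g : F) (l : List F) :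
    M.nestedProd ((r • g) :: l) = r • M.nestedProd (g :: l) := by
  cases l <;> simp [nestedProd]

theorem nestedProd_cons (g : F) {l : List F} (hl : l ≠ []) :
    M.nestedProd (g :: l) = M.mul g (M.nestedProd l) := by
  cases l with
  | nil => exact absurd rfl hl
  | cons => rfl

/-- The term `c x^a` is absorbed into the first factor; the bound by 1 keeps the new multidegree
squarefree. -/
theorem monomial_smul_mem_nestedParts {p : ℕ} {e : Fin n → ℤ} {s : F}
    (hs : s ∈ M.nestedParts (p + 1) e) (a : Fin n →₀ ℕ) (c : k)
    (hae : (fun i => (a i : ℤ)) + e ≤ 1) :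
    monomial a c • s ∈ M.nestedParts (p + 1) ((fun i => (a i : ℤ)) + e) := by
  obtain ⟨l, hl, hg, D, a', hD, hDe, hse, heq⟩ := hs
  cases l with
  | nil => simp at hl
  | cons g l =>
    refine ⟨(monomial a c • g) :: l, hl, ?_, (fun i => (a i : ℤ)) + D, a', ?_, ?_,
      hse.monomial_smul a c, ?_⟩
    · intro x hx
      rcases List.mem_cons.1 hx with rfl | hx
      · obtain ⟨h1, d, hd⟩ := hg g (by simp)
        exact ⟨Submodule.smul_mem _ _ h1, _, hd.monomial_smul a c⟩
      · exact hg x (List.mem_cons_of_mem _ hx)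
    · rw [nestedProd_smul_cons]
      exact hD.monomial_smul a c
    · ext i
      have h1 := congrFun hDe i
      have h2 := hae i
      simp only [Pi.add_apply, Pi.inf_apply, Pi.one_apply] at h1 h2 ⊢
      omega
    · rw [nestedProd_smul_cons, heq, smul_comm]

theorem monomial_smul_mem_closure {p : ℕ} {e : Fin n → ℤ} {s : F}
    (hs : s ∈ AddSubmonoid.closure (M.nestedParts (p + 1) e)) (a : Fin n →₀ ℕ) (c : k)
    (hae : (fun i => (a i : ℤ)) + e ≤ 1) :
    monomial a c • s ∈
      AddSubmonoid.closure (M.nestedParts (p + 1) ((fun i => (a i : ℤ)) + e)) := by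
  induction hs using AddSubmonoid.closure_induction with
  | mem x hx => exact AddSubmonoid.subset_closure (M.monomial_smul_mem_nestedParts hx a c hae)
  | zero => rw [smul_zero]; exact zero_mem _
  | add x y _ _ hx hy => rw [smul_add]; exact add_mem hx hy

/-- Taking squarefree parts at an intermediate stage is harmless: if the inner product is `x^{a'}
s`, bilinearity makes the full product `x^{a'+a} z`. -/
theorem mem_nestedParts_of_mul {p : ℕ} {e : Fin n → ℤ} {a : Fin n →₀ ℕ} {g s z : F}
    (hs : s ∈ M.nestedParts (p + 1) e) (hg : g ∈ R.comp 1)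
    (hga : R.HasMultidegree (fun i => (a i : ℤ)) g) (hae : ((fun i => (a i : ℤ)) + e) ⊓ 1 = e)
    (hz : R.HasMultidegree e z) (heq : M.mul g s = monomial a (1 : k) • z) :
    z ∈ M.nestedParts (p + 2) e := by
  obtain ⟨l, hl, hgl, D, a', hD, hDe, hse, hP⟩ := hs
  have hne : l ≠ [] := by rintro rfl; simp at hl
  refine ⟨g :: l, by simp [hl], ?_, (fun i => (a i : ℤ)) + D, a' + a, ?_, ?_, hz, ?_⟩
  · intro x hx
    rcases List.mem_cons.1 hx with rfl | hx
    · exact ⟨hg, _, hga⟩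
    · exact hgl x hx
  · rw [M.nestedProd_cons g hne]
    exact M.mul_multidegree _ _ _ _ hga hD
  · ext i
    have h1 := congrFun hDe i
    have h2 := congrFun hae i
    simp only [Pi.add_apply, Pi.inf_apply, Pi.one_apply] at h1 h2 ⊢
    omega
  · rw [M.nestedProd_cons g hne, hP, map_smul, heq, ← mul_smul, monomial_mul, one_mul]

theorem exists_mem_closure_of_mul (hI : IsSquarefreeMonomialIdeal I) {p : ℕ} {e : Fin n → ℤ}
    {a : Fin n →₀ ℕ} {g s : F}
    (hs : s ∈ AddSubmonoid.closure (M.nestedParts (p + 1) e)) (hg : g ∈ R.comp 1)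
    (hga : R.HasMultidegree (fun i => (a i : ℤ)) g)
    (hae : ((fun i => (a i : ℤ)) + e) ⊓ 1 = e) :
    ∃ z ∈ AddSubmonoid.closure (M.nestedParts (p + 2) e),
      M.mul g s = monomial a (1 : k) • z := by
  induction hs using AddSubmonoid.closure_induction with
  | mem x hx =>
    have hxe : R.HasMultidegree e x := by
      obtain ⟨-, -, -, -, -, -, -, h, -⟩ := hx
      exact h
    obtain ⟨z, hz, heq⟩ :=
      (M.mul_multidegree _ _ _ _ hga hxe).exists_squarefreePart (R.mdeg_le_one hI) hae
    exact ⟨z, AddSubmonoid.subset_closure (M.mem_nestedParts_of_mul hx hg hga hae hz heq), heq⟩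
  | zero => exact ⟨0, zero_mem _, by simp⟩
  | add x y _ _ hx hy =>
    obtain ⟨z, hz, hxz⟩ := hx
    obtain ⟨w, hw, hyw⟩ := hy
    exact ⟨z + w, add_mem hz hw, by rw [map_add, hxz, hyw, smul_add]⟩

theorem mem_closure_of_basis_mem {p : ℕ} {e : Fin n → ℤ} (he : e ≤ 1) {f : F}
    (hfe : R.HasMultidegree e f)
    (h : ∀ b, R.basis.repr f b ≠ 0 →
      R.basis b ∈ AddSubmonoid.closure (M.nestedParts (p + 1) (R.mdeg b))) :
    f ∈ AddSubmonoid.closure (M.nestedParts (p + 1) e) := by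
  rw [← R.basis.linearCombination_repr f, Finsupp.linearCombination_apply, Finsupp.sum]
  refine AddSubmonoid.sum_mem _ fun b hb => ?_
  rw [Finsupp.mem_support_iff] at hb
  obtain ⟨a, c, -, hac, rfl⟩ := hfe.repr_eq_monomial hb
  rw [hac]
  exact M.monomial_smul_mem_closure (h b hb) a c he

theorem mem_closure_nestedParts (hI : IsSquarefreeMonomialIdeal I) (p : ℕ) {e : Fin n → ℤ}
    (he : e ≤ 1) {f : F} (hf : f ∈ R.comp (p + 1)) (hfe : R.HasMultidegree e f) :
    f ∈ AddSubmonoid.closure (M.nestedParts (p + 1) e) := by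
  induction p generalizing e f with
  | zero =>
    refine AddSubmonoid.subset_closure ⟨[f], rfl, by simpa using ⟨hf, e, hfe⟩, e, 0, hfe,
      inf_eq_left.2 he, hfe, ?_⟩
    rw [← one_def, one_smul]
    rfl
  | succ p ih =>
    refine M.mem_closure_of_basis_mem he hfe fun b hb => ?_
    replace hb := R.mem_comp_iff.1 hf b hb
    clear hf hfe he e f
    induction hN : (∑ i, R.mdeg b i).toNat using Nat.strong_induction_on generalizing b with
    | _ N ihN =>
    subst hN
    have hbc : R.basis b ∈ R.comp (p + 2) := hb ▸ R.basis_mem_comp b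
    have hbm := R.hasMultidegree_basis b
    have hb1 := R.mdeg_le_one hI b
    obtain ⟨g, hg, a, hga, hgd, hab⟩ := R.exists_monomial_le_mdeg hb
    -- Since `0 ≤ a ≤ mdeg b ≤ 1`, adding `a` raises only coordinates already equal to 1.
    have hae : ((fun i => (a i : ℤ)) + R.mdeg b) ⊓ 1 = R.mdeg b := by
      ext i
      have h1 := hab i
      have h2 := hb1 i
      simp only [Pi.add_apply, Pi.inf_apply, Pi.one_apply] at h1 h2 ⊢
      omega
    obtain ⟨v, hv, hvm, hbv⟩ := M.exists_one_mul_eq hbc hbm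
    obtain ⟨z, hz, hgz⟩ := M.exists_mem_closure_of_mul hI
      (ih hb1 (R.d_succ _ _ hv) (R.d_multidegree _ _ hvm)) hg hga hae
    obtain ⟨y, hy, hgy⟩ :=
      (M.mul_multidegree _ _ _ _ hga hvm).exists_squarefreePart (R.mdeg_le_one hI) hae
    -- Leibniz for `g * v` with `∂g = x^a` and `1 * v = b`, after cancelling `x^a`.
    have hsum : R.basis b = R.d y + z := by
      apply monomial_smul_injective (a := a) _ R.toMultigradedFree
      have := M.leibniz 1 g hg v
      rw [hgy, hgd, map_smul, map_smul, LinearMap.smul_apply, hbv, hgz] at this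
      rw [smul_add, this]
      simp
    have hzc : z ∈ R.comp (p + 2) := by
      apply mem_comp_of_monomial_smul (a := a)
      rw [← hgz, add_comm p 2, show 2 + p = 1 + (p + 1) by ring]
      exact M.mul_mem_comp 1 (p + 1) _ hg _ (R.d_succ _ _ hv)
    have hyc : R.d y ∈ R.comp (p + 2) := by
      rw [← sub_eq_of_eq_add hsum]
      exact sub_mem hbc hzc
    rw [hsum]
    refine add_mem (M.mem_closure_of_basis_mem hb1 (R.d_multidegree _ _ hy) fun b' hb' => ?_) hz
    have hb'c := R.mem_comp_iff.1 hyc b' hb'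
    refine ihN _ ?_ b' hb'c rfl
    exact R.sum_mdeg_toNat_lt (R.d_multidegree _ _ hy) hb'c hb'

end Multiplication

end SqfRes
theorem proposition3p4 {k : Type*} [Field k] {n : ℕ}
    (I : Ideal (MvPolynomial (Fin n) k)) (hI : SqfRes.IsSquarefreeMonomialIdeal I)
    {B F : Type*} [AddCommGroup F] [Module (MvPolynomial (Fin n) k) F]
    (R : SqfRes.MinimalResolution I B F) (M : SqfRes.Multiplication R)
    (p : ℕ) (hp : 1 ≤ p) (e : Fin n → ℤ) (he : e ≤ 1)
    (f : F) (hf : f ∈ R.comp p) (hfe : R.HasMultidegree e f) :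
    ∃ (N : ℕ) (g : Fin N → Fin p → F) (s : Fin N → F),
      (∀ j l, g j l ∈ R.comp 1 ∧ ∃ d, R.HasMultidegree d (g j l)) ∧
      (∀ j, R.IsSquarefreePart (M.nestedProd (List.ofFn (g j))) (s j)) ∧
      f = ∑ j, s j := by
  obtain ⟨p, rfl⟩ := Nat.exists_eq_add_of_le' hp
  obtain ⟨l, hl, rfl⟩ :=
    AddSubmonoid.exists_list_of_mem_closure (M.mem_closure_nestedParts hI p he hf hfe)
  have hget : ∀ j : Fin l.length, ∃ g : Fin (p + 1) → F,
      (∀ i, g i ∈ R.comp 1 ∧ ∃ d, R.HasMultidegree d (g i)) ∧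
      R.IsSquarefreePart (M.nestedProd (List.ofFn g)) (l.get j) := by
    intro j
    obtain ⟨q, hq, hg, D, a, hD, hDe, hs, heq⟩ := hl _ (List.get_mem l j)
    refine ⟨fun i => q.get (i.cast hq.symm), fun i => hg _ (List.get_mem _ _), ?_⟩
    have hof : List.ofFn (fun i => q.get (Fin.cast hq.symm i)) = q :=
      List.ext_getElem (by rw [List.length_ofFn, hq]) fun i _ _ => by
        rw [List.getElem_ofFn]
        rfl
    rw [hof]
    exact ⟨D, a, hD, hDe.symm ▸ hs, heq⟩
  choose g hg hs using hget
  refine ⟨l.length, g, l.get, hg, hs, ?_⟩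
  rw [← List.sum_ofFn, List.ofFn_get]
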